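/- Let $K\subset\mathbb R^2$ be a compact body, i.e. a non-empty compact set that is the closure of its interior, and suppose that $K$ is connected. Let $\mu$ be a probability measure on the Borel $\sigma$-algebra of $K$ such that \[ \mu(B(p,\varepsilon)\cap K)>0\quad\text{for all }p\in K,\ \varepsilon>0, \] where $B(p,\varepsilon)$ is the open Euclidean ball with center $p$ and radius $\varepsilon$, and \[ \mu(\{(\alpha,\beta)\in K:\alpha=x\})=\mu(\{(\alpha,\beta)\in K:\beta=y\})=0\quad\text{for all }x,y\in\mathbb R . \] Define $F_{K,\mu}:\mathbb R^2\to\mathbb R$ by $F_{K,\mu}(x,y)=\int_K\bigl(|x-\alpha|+|y-\beta|\bigr)\,\mu(d\alpha,d\beta)$. Let $(t_k)_{k\ge1}$ be a non-increasing sequence of positive numbers with $\sum_{k\ge1}t_k=\infty$ and $\sum_{k\ge1}t_k^2<\infty$, let $(P_k)_{k\ge1}$ be independent $\mathbb R^2$-valued random variables on a probability space $(\Omega,\mathcal F,\mathbb P)$ with common distribution $\mu$ (regarded as a Borel measure on $\mathbb R^2$), and let $x_0\in K$. Define $X_0=x_0$ and, for $k\ge0$, \[ X_{k+1}=X_k-t_{k+1}Q_{k+1},\qquad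 Q_{k+1}=\bigl(s(X_k^{(1)}-P_{k+1}^{(1)}),\,s(X_k^{(2)}-P_{k+1}^{(2)})\bigr), \] where $s(u)=1$ if $u\ge0$ and $s(u)=-1$ if $u<0$. Then $F_{K,\mu}$ has a unique global minimizer $X^*\in\mathbb R^2$, and $X_n$ converges to $X^*$ almost surely and in $L^q$ for every integer $q\ge1$: $\mathbb P(\lim_{n\to\infty}X_n=X^*)=1$, and $X_n\in L^q$ for all $n$ with $\lim_{n\to\infty}\mathbb E\|X_n-X^*\|^q=0$, where $\|\cdot\|$ is the Euclidean norm. -/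

import Mathlib

open MeasureTheory ProbabilityTheory Filter Topology

/-- The plane `ℝ²` with its Euclidean norm; coordinates are indexed by `0` and `1`. -/
abbrev Plane : Type := EuclideanSpace ℝ (Fin 2)

/-- A compact body: a non-empty compact set which is the closure of its interior. -/
def IsCompactBody (K : Set Plane) : Prop :=
  K.Nonempty ∧ IsCompact K ∧ closure (interior K) = K

/-- The taxicab distance `d₁` on the plane. -/
def taxicabDist (x y : Plane) : ℝ := |x 0 - y 0| + |x 1 - y 1|

/-- The generalized conic function `F_{K,μ}(x) = ∫_K d₁(x, p) μ(dp)`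
of a measure `μ` on the Borel sets of `K`. -/
noncomputable def conicFunction (K : Set Plane) (μ : Measure K) (x : Plane) : ℝ :=
  ∫ p : K, taxicabDist x p ∂μ

/-- `a` is the unique global minimizer of `F`: it is a global minimizer, and there is no other. -/
def IsUniqueGlobalMinimizer (F : Plane → ℝ) (a : Plane) : Prop :=
  (∀ x, F a ≤ F x) ∧ ∀ b, (∀ x, F b ≤ F x) → b = a

/-- The direction of one step of the algorithm, from the current point `x` and the sample `p`. -/
noncomputable def signStep (x p : Plane) : Plane :=
  if p 0 ≤ x 0 then
    if p 1 ≤ x 1 then !₂[1, 1] else !₂[1, -1]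
  else
    if p 1 ≤ x 1 then !₂[-1, 1] else !₂[-1, -1]

/-- The recursion `X₀ = x₀`, `X_{k+1} = X_k - t_{k+1} Q_{k+1}`, where `Q_{k+1}` is the
direction determined by `X_k` and the sample `P_{k+1}`. The values `t 0` and `P 0` are not used. -/
noncomputable def stochasticRecursion {Ω : Type*} (t : ℕ → ℝ) (P : ℕ → Ω → Plane) (x₀ : Plane) :
    ℕ → Ω → Plane
  | 0, _ => x₀
  | k + 1, ω =>
      stochasticRecursion t P x₀ k ω -
        t (k + 1) • signStep (stochasticRecursion t P x₀ k ω) (P (k + 1) ω)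

/-!
The two coordinates of the recursion do not interact: each is the walk
`x (k + 1) = x k - τ k * signAt (x k) (p k)` on the line driven by independent samples `p k` of the
coordinate law `ρ` of `μ`, and `F_{K,μ}` is the sum of the two functions `x ↦ ∫ |x - a| ρ(da)`.

Let `g x = meanSign ρ x = 2 ρ(-∞, x] - 1`, a subgradient of `x ↦ ∫ |x - a| ρ(da)`. As `ρ` has no
atoms, `g` has a zero `m` (a median of `ρ`); as `K` is connected and `μ` charges every ball around
a point of `K`, the support of `ρ` is an interval (`coordLaw_Ioo_pos`), so that `g` changes sign
strictly at `m` (`exists_strict_median`). The subgradient inequality makes `m` the only minimizer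
(`integral_abs_sub_lt_of_ne`).

For convergence of the walk, write
`x (k + 1) = x k - τ k * g (x k) + τ k * (g (x k) - signAt (x k) (p k))`.
The last terms are the increments of a martingale, bounded in `L²` because `∑ τ k ^ 2 < ∞`, hence
almost surely convergent (`ae_exists_tendsto_walkNoise`). On a path where it converges, subtracting
it leaves a recursion with drift `-τ k * g (x k)`, which pushes towards `m` at a rate bounded below
away from `m`; since `∑ τ k = ∞` and `τ k → 0`, the path tends to `m`
(`tendsto_of_perturbed_drift`). The walk stays in a bounded interval almost surely, so convergence
in `L^q` follows by dominated convergence (`memLp_and_tendsto_integral_norm_pow`).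
-/

/-! ### A deterministic recursion with a restoring drift -/

/-- One-sided form of the deterministic convergence argument: far above the target the drift pushes
down by a fixed amount per unit of the divergent clock `∑ τ k`, and the upward moves elsewhere are
at most `τ n → 0`. -/
lemma eventually_le_of_drift {z v τ : ℕ → ℝ}
    (hz : ∀ n, z (n + 1) = z n - τ n * v n) (hτ0 : ∀ n, 0 < τ n)
    (hτ : Tendsto τ atTop (𝓝 0))
    (hsum : Tendsto (fun n => ∑ k ∈ Finset.range n, τ k) atTop atTop)
    (hv : ∀ n, -1 ≤ v n)
    (hdrift : ∀ ε > 0, ∃ δ > 0, ∀ᶠ n in atTop, ε < z n → δ ≤ v n) {ε : ℝ} (hε : 0 < ε) :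
    ∀ᶠ n in atTop, z n ≤ ε := by
  obtain ⟨δ, hδ, hev⟩ := hdrift (ε / 2) (by positivity)
  have hsmall : ∀ᶠ n in atTop, τ n < ε / 2 := hτ.eventually_lt_const (by positivity)
  obtain ⟨N, hN⟩ := eventually_atTop.1 (hev.and hsmall)
  have hent : ∃ n ≥ N, z n ≤ ε := by
    by_contra! hcon
    have hbound : ∀ n ≥ N, z n ≤ z N -
        δ * (∑ k ∈ Finset.range n, τ k - ∑ k ∈ Finset.range N, τ k) := by
      intro n hn
      induction n, hn using Nat.le_induction with
      | base => simp
      | succ n hn ih =>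
        have h1 := (hN n hn).1 (by linarith [hcon n hn])
        have h2 := mul_le_mul_of_nonneg_left h1 (hτ0 n).le
        rw [hz, Finset.sum_range_succ]
        linarith
    obtain ⟨n, hn1, hn2⟩ := ((eventually_ge_atTop N).and (hsum.eventually_gt_atTop
      (z N / δ + ∑ k ∈ Finset.range N, τ k))).exists
    have h1 := hbound n hn1
    have h2 : δ * (z N / δ) < δ * (∑ k ∈ Finset.range n, τ k - ∑ k ∈ Finset.range N, τ k) :=
      mul_lt_mul_of_pos_left (by linarith) hδ
    rw [mul_div_cancel₀ _ hδ.ne'] at h2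
    linarith [hcon n hn1]
  obtain ⟨n₀, hn₀, hz₀⟩ := hent
  refine eventually_atTop.2 ⟨n₀, fun n hn => ?_⟩
  induction n, hn using Nat.le_induction with
  | base => exact hz₀
  | succ n hn ih =>
    rw [hz]
    by_cases h : ε / 2 < z n
    · have h1 := (hN n (by omega)).1 h
      have := mul_nonneg (hτ0 n).le (hδ.le.trans h1)
      linarith
    · have h1 := (hN n (by omega)).2
      have := mul_le_mul_of_nonneg_left (hv n) (hτ0 n).le
      linarith

/-- If `g` is monotone, bounded by `1`, and changes sign strictly at `m`, then the recursion
`x (n + 1) = x n - τ n * g (x n) + (M (n + 1) - M n)` with convergent perturbation `M` tends to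
`m`. -/
lemma tendsto_of_perturbed_drift {x M τ : ℕ → ℝ} {g : ℝ → ℝ} {m L : ℝ}
    (hx : ∀ n, x (n + 1) = x n - τ n * g (x n) + (M (n + 1) - M n)) (hτ0 : ∀ n, 0 < τ n)
    (hτ : Tendsto τ atTop (𝓝 0))
    (hsum : Tendsto (fun n => ∑ k ∈ Finset.range n, τ k) atTop atTop)
    (hg1 : ∀ u, |g u| ≤ 1) (hmono : Monotone g)
    (hpos : ∀ u, m < u → 0 < g u) (hneg : ∀ u, u < m → g u < 0)
    (hM : Tendsto M atTop (𝓝 L)) : Tendsto x atTop (𝓝 m) := by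
  -- `z n` absorbs the perturbation: its recursion has no noise and `z n - (x n - m) → 0`.
  set z : ℕ → ℝ := fun n => x n - M n + L - m with hzdef
  have hz : ∀ n, z (n + 1) = z n - τ n * g (x n) := by
    intro n; simp only [hzdef, hx n]; ring
  have hclose : ∀ ε > 0, ∀ᶠ n in atTop, |M n - L| < ε := fun ε hε => by
    simpa [Real.dist_eq] using (Metric.tendsto_nhds.1 hM) ε hε
  have hup : ∀ ε > 0, ∀ᶠ n in atTop, z n ≤ ε := fun ε hε => by
    refine eventually_le_of_drift hz hτ0 hτ hsum (fun n => (abs_le.1 (hg1 _)).1) ?_ hε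
    intro ε hε
    refine ⟨g (m + ε / 2), hpos _ (by linarith), ?_⟩
    filter_upwards [hclose (ε / 2) (by positivity)] with n hn h
    apply hmono
    have := abs_lt.1 hn
    simp only [hzdef] at h
    linarith
  have hdown : ∀ ε > 0, ∀ᶠ n in atTop, -z n ≤ ε := fun ε hε => by
    refine eventually_le_of_drift (z := fun n => -z n) (v := fun n => -g (x n))
      (fun n => by rw [hz]; ring) hτ0 hτ hsum
      (fun n => by linarith [(abs_le.1 (hg1 (x n))).2]) ?_ hε
    intro ε hε
    refine ⟨-g (m - ε / 2), by linarith [hneg (m - ε / 2) (by linarith)], ?_⟩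
    filter_upwards [hclose (ε / 2) (by positivity)] with n hn h
    have := abs_lt.1 hn
    simp only [hzdef] at h
    exact neg_le_neg (hmono (by linarith))
  refine Metric.tendsto_nhds.2 fun ε hε => ?_
  filter_upwards [hclose (ε / 2) (by positivity), hup (ε / 4) (by positivity),
    hdown (ε / 4) (by positivity)] with n h1 h2 h3
  have := abs_lt.1 h1
  simp only [hzdef] at h2 h3
  rw [Real.dist_eq, abs_lt]
  constructor <;> linarith

/-! ### Medians and the mean sign -/

/-- The sign of `x - a`, with the value `1` for `x = a`. -/
noncomputable def signAt (x a : ℝ) : ℝ := if a ≤ x then 1 else -1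

/-- The mean of `signAt x` under `ρ`: a subgradient at `x` of the function `x ↦ ∫ |x - a| ρ(da)`.
It vanishes at `x` iff `x` splits the mass of `ρ` evenly. -/
noncomputable def meanSign (ρ : Measure ℝ) (x : ℝ) : ℝ := ∫ a, signAt x a ∂ρ

lemma abs_signAt (x a : ℝ) : |signAt x a| = 1 := by
  unfold signAt; split_ifs <;> simp

lemma measurable_signAt : Measurable (fun q : ℝ × ℝ => signAt q.1 q.2) :=
  Measurable.ite (measurableSet_le measurable_snd measurable_fst) measurable_const measurable_const

lemma integrable_signAt (ρ : Measure ℝ) [IsProbabilityMeasure ρ] (x : ℝ) :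
    Integrable (signAt x) ρ :=
  Integrable.of_bound (measurable_signAt.comp measurable_prodMk_left).aestronglyMeasurable 1
    (ae_of_all _ fun a => (abs_signAt x a).le)

lemma meanSign_eq (ρ : Measure ℝ) [IsProbabilityMeasure ρ] (x : ℝ) :
    meanSign ρ x = 2 * cdf ρ x - 1 := by
  have h : signAt x = fun a => 2 * (Set.Iic x).indicator 1 a - 1 := by
    funext a
    by_cases h : a ≤ x
    · simp [signAt, h]; norm_num
    · simp [signAt, h]
  have hi : Integrable ((Set.Iic x).indicator (1 : ℝ → ℝ)) ρ :=
    (integrable_const (1 : ℝ)).indicator measurableSet_Iic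
  rw [meanSign, h, integral_sub (hi.const_mul 2) (integrable_const _), integral_const_mul,
    integral_indicator_one measurableSet_Iic, cdf_eq_real]
  simp

lemma abs_meanSign_le (ρ : Measure ℝ) [IsProbabilityMeasure ρ] (x : ℝ) : |meanSign ρ x| ≤ 1 := by
  rw [meanSign_eq, abs_le]
  constructor <;> linarith [cdf_nonneg ρ x, cdf_le_one ρ x]

lemma monotone_meanSign (ρ : Measure ℝ) [IsProbabilityMeasure ρ] : Monotone (meanSign ρ) := by
  intro x y h
  rw [meanSign_eq, meanSign_eq]
  linarith [monotone_cdf ρ h]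

lemma continuous_cdf_of_noAtoms (ρ : Measure ℝ) [IsProbabilityMeasure ρ] [NullSingletonClass ρ] :
    Continuous (cdf ρ) := by
  refine continuous_iff_continuousAt.2 fun x => ?_
  rw [(monotone_cdf ρ).continuousAt_iff_leftLim_eq_rightLim, StieltjesFunction.rightLim_eq]
  have h : (cdf ρ).measure {x} = 0 := by rw [measure_cdf]; exact measure_singleton x
  rw [StieltjesFunction.measure_singleton, ENNReal.ofReal_eq_zero] at h
  exact le_antisymm ((monotone_cdf ρ).leftLim_le le_rfl) (by linarith)

lemma exists_cdf_eq_half (ρ : Measure ℝ) [IsProbabilityMeasure ρ] [NullSingletonClass ρ] :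
    ∃ m, cdf ρ m = 1 / 2 := by
  refine mem_range_of_exists_le_of_exists_ge (continuous_cdf_of_noAtoms ρ) ?_ ?_
  · exact ((tendsto_cdf_atBot ρ).eventually_le_const (by norm_num)).exists
  · exact ((tendsto_cdf_atTop ρ).eventually_const_le (by norm_num)).exists

/-- An atomless law on the line whose support has no gap has a median `m` at which the mean sign
changes sign strictly. -/
lemma exists_strict_median (ρ : Measure ℝ) [IsProbabilityMeasure ρ] [NullSingletonClass ρ]
    (hgap : ∀ c d, c < d → 0 < ρ (Set.Iic c) → 0 < ρ (Set.Ici d) → 0 < ρ (Set.Ioo c d)) :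
    ∃ m, meanSign ρ m = 0 ∧ (∀ u, m < u → 0 < meanSign ρ u) ∧ ∀ u, u < m → meanSign ρ u < 0 := by
  obtain ⟨m, hm⟩ := exists_cdf_eq_half ρ
  -- An interval between two points with equal `cdf` is null; if `cdf` is neither `0` nor `1` there,
  -- this would be a gap.
  have key : ∀ c d, c < d → cdf ρ c = cdf ρ d → 0 < cdf ρ c → cdf ρ d < 1 → False := by
    intro c d hcd heq h0 h1
    have hc : 0 < ρ (Set.Iic c) := by
      rw [← ofReal_cdf]; exact ENNReal.ofReal_pos.2 h0
    have hd : 0 < ρ (Set.Ici d) := by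
      have : ρ (Set.Ioi d) = 1 - ρ (Set.Iic d) := by
        rw [← Set.compl_Iic]; exact prob_compl_eq_one_sub measurableSet_Iic
      refine lt_of_lt_of_le ?_ (measure_mono Set.Ioi_subset_Ici_self)
      rw [this, ← ofReal_cdf, tsub_pos_iff_lt]
      exact ENNReal.ofReal_lt_one.2 h1
    have h2 : ρ (Set.Ioc c d) = 0 := by
      rw [← measure_cdf ρ, StieltjesFunction.measure_Ioc, heq, sub_self, ENNReal.ofReal_zero]
    exact (hgap c d hcd hc hd).ne' (measure_mono_null Set.Ioo_subset_Ioc_self h2)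
  refine ⟨m, by rw [meanSign_eq, hm]; norm_num, fun u hu => ?_, fun u hu => ?_⟩
  · rw [meanSign_eq]
    have hle := monotone_cdf ρ hu.le
    have hne : cdf ρ m ≠ cdf ρ u := fun h =>
      key m u hu h (by rw [hm]; norm_num) (by rw [← h, hm]; norm_num)
    have := lt_of_le_of_ne hle hne
    linarith
  · rw [meanSign_eq]
    have hle := monotone_cdf ρ hu.le
    have hne : cdf ρ u ≠ cdf ρ m := fun h =>
      key u m hu h (by rw [h, hm]; norm_num) (by rw [hm]; norm_num)
    have := lt_of_le_of_ne hle hne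
    linarith

lemma integral_abs_sub_subgradient (ρ : Measure ℝ) [IsProbabilityMeasure ρ]
    (hint : ∀ x, Integrable (fun a => |x - a|) ρ) (x y : ℝ) :
    ∫ a, |y - a| ∂ρ + (x - y) * meanSign ρ y ≤ ∫ a, |x - a| ∂ρ := by
  rw [meanSign, ← integral_const_mul, ← integral_add (hint y) ((integrable_signAt ρ y).const_mul _)]
  refine integral_mono ((hint y).add ((integrable_signAt ρ y).const_mul _)) (hint x) fun a => ?_
  simp only [signAt]
  split_ifs with h
  · rw [abs_of_nonneg (sub_nonneg.2 h)]
    linarith [le_abs_self (x - a)]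
  · rw [abs_of_neg (by linarith)]
    linarith [neg_abs_le (x - a)]

lemma integral_abs_sub_lt_of_ne (ρ : Measure ℝ) [IsProbabilityMeasure ρ]
    (hint : ∀ x, Integrable (fun a => |x - a|) ρ) {m x : ℝ} (hm : meanSign ρ m = 0)
    (hpos : ∀ u, m < u → 0 < meanSign ρ u) (hneg : ∀ u, u < m → meanSign ρ u < 0) (hx : x ≠ m) :
    ∫ a, |m - a| ∂ρ < ∫ a, |x - a| ∂ρ := by
  -- The subgradient at `m` vanishes, so the strict increase comes from the midpoint.
  have h1 := integral_abs_sub_subgradient ρ hint ((m + x) / 2) m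
  have h2 := integral_abs_sub_subgradient ρ hint x ((m + x) / 2)
  have h3 : 0 < (x - (m + x) / 2) * meanSign ρ ((m + x) / 2) := by
    rcases lt_or_gt_of_ne hx with h | h
    · exact mul_pos_of_neg_of_neg (by linarith) (hneg _ (by linarith))
    · exact mul_pos (by linarith) (hpos _ (by linarith))
  rw [hm, mul_zero] at h1
  linarith

/-! ### The one-dimensional random walk and its noise martingale -/

/-- The coordinate recursion `x₀`, `x (k + 1) = x k - τ k * signAt (x k) (p k)`. Here `τ` and `p` are
indexed from `0`: step number `k + 1` uses `τ k` and `p k`. -/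
noncomputable def signWalk {Ω : Type*} (τ : ℕ → ℝ) (p : ℕ → Ω → ℝ) (x₀ : ℝ) : ℕ → Ω → ℝ
  | 0, _ => x₀
  | k + 1, ω => signWalk τ p x₀ k ω - τ k * signAt (signWalk τ p x₀ k ω) (p k ω)

/-- The accumulated centred noise of the walk: at step `k` the noise is `τ k` times the difference
between the mean `meanSign ρ (x k)` of the sign and its sampled value `signAt (x k) (p k)`. -/
noncomputable def walkNoise {Ω : Type*} (ρ : Measure ℝ) (τ : ℕ → ℝ) (p : ℕ → Ω → ℝ) (x₀ : ℝ)
    (n : ℕ) (ω : Ω) : ℝ :=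
  ∑ k ∈ Finset.range n, τ k *
    (meanSign ρ (signWalk τ p x₀ k ω) - signAt (signWalk τ p x₀ k ω) (p k ω))

/-- The filtration whose `n`-th σ-algebra is generated by the samples `p k` with `k < n`, and hence
is trivial for `n = 0`. -/
def pastFiltration {Ω : Type*} [mΩ : MeasurableSpace Ω] (p : ℕ → Ω → ℝ)
    (hp : ∀ k, Measurable (p k)) : Filtration ℕ mΩ where
  seq n := ⨆ k ∈ Set.Iio n, MeasurableSpace.comap (p k) inferInstance
  mono' _ _ h := biSup_mono fun _ hk => lt_of_lt_of_le hk h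
  le' _ := iSup₂_le fun k _ => (hp k).comap_le

section

variable {Ω : Type*} {ρ : Measure ℝ} {τ : ℕ → ℝ} {p : ℕ → Ω → ℝ} {x₀ : ℝ}

lemma signWalk_succ (k : ℕ) (ω : Ω) : signWalk τ p x₀ (k + 1) ω =
    signWalk τ p x₀ k ω - τ k * signAt (signWalk τ p x₀ k ω) (p k ω) := rfl

lemma walkNoise_succ (n : ℕ) (ω : Ω) : walkNoise ρ τ p x₀ (n + 1) ω = walkNoise ρ τ p x₀ n ω +
    τ n * (meanSign ρ (signWalk τ p x₀ n ω) - signAt (signWalk τ p x₀ n ω) (p n ω)) :=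
  Finset.sum_range_succ _ _

lemma abs_noiseTerm_le [IsProbabilityMeasure ρ] (hτ : ∀ k, 0 < τ k) (k : ℕ) (ω : Ω) :
    |τ k * (meanSign ρ (signWalk τ p x₀ k ω) - signAt (signWalk τ p x₀ k ω) (p k ω))| ≤ 2 * τ k := by
  rw [abs_mul, abs_of_pos (hτ k), mul_comm]
  refine mul_le_mul_of_nonneg_right ?_ (hτ k).le
  have h1 := abs_meanSign_le ρ (signWalk τ p x₀ k ω)
  have h2 := (abs_signAt (signWalk τ p x₀ k ω) (p k ω)).le
  linarith [abs_sub (meanSign ρ (signWalk τ p x₀ k ω)) (signAt (signWalk τ p x₀ k ω) (p k ω))]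

lemma abs_walkNoise_le [IsProbabilityMeasure ρ] (hτ : ∀ k, 0 < τ k) (n : ℕ) (ω : Ω) :
    |walkNoise ρ τ p x₀ n ω| ≤ ∑ k ∈ Finset.range n, 2 * τ k :=
  (Finset.abs_sum_le_sum_abs _ _).trans (Finset.sum_le_sum fun k _ => abs_noiseTerm_le hτ k ω)

/-- The walk overshoots the range of its samples by at most one step. -/
lemma signWalk_mem_Icc {a b : ℝ} (hx₀ : x₀ ∈ Set.Icc a b) (hτ : ∀ k, 0 < τ k) (hanti : Antitone τ)
    {ω : Ω} (hω : ∀ k, p k ω ∈ Set.Icc a b) (n : ℕ) :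
    signWalk τ p x₀ n ω ∈ Set.Icc (a - τ 0) (b + τ 0) := by
  have h0 := hτ 0
  induction n with
  | zero => exact ⟨(sub_le_self a h0.le).trans hx₀.1, hx₀.2.trans (le_add_of_nonneg_right h0.le)⟩
  | succ n ih =>
    have h1 := hτ n
    have h2 := hanti n.zero_le
    obtain ⟨h3, h4⟩ := hω n
    obtain ⟨h5, h6⟩ := ih
    rw [signWalk_succ, signAt]
    split_ifs with h
    · exact ⟨by linarith, by linarith⟩
    · exact ⟨by linarith, by linarith⟩

end

lemma measurable_meanSign (ρ : Measure ℝ) [IsProbabilityMeasure ρ] : Measurable (meanSign ρ) :=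
  (monotone_meanSign ρ).measurable

/-- A fresh sample may be integrated out with the past frozen: for `U`, `X` known in `𝓖` and `Q`
independent of `𝓖` with law `ρ`, the sign of `X - Q` can be replaced by its mean. -/
lemma integral_mul_signAt_of_indep {Ω : Type*} {𝓖 mΩ : MeasurableSpace Ω}
    {ν : Measure Ω} {ρ : Measure ℝ} [IsProbabilityMeasure ν] [IsProbabilityMeasure ρ]
    (h𝓖 : 𝓖 ≤ mΩ) {U X Q : Ω → ℝ} (hU : Measurable[𝓖] U)
    (hX : Measurable[𝓖] X) (hQ : Measurable Q)
    (hind : Indep 𝓖 (MeasurableSpace.comap Q inferInstance) ν)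
    (hlaw : ν.map Q = ρ) (hUint : Integrable U ν) :
    ∫ ω, U ω * signAt (X ω) (Q ω) ∂ν = ∫ ω, U ω * meanSign ρ (X ω) ∂ν := by
  have hUX' : Measurable[𝓖] fun ω => (U ω, X ω) := hU.prodMk hX
  have hUX : Measurable[mΩ] fun ω => (U ω, X ω) := hUX'.mono h𝓖 le_rfl
  have hIF : IndepFun (fun ω => (U ω, X ω)) Q ν :=
    indep_of_indep_of_le_left hind hUX'.comap_le
  have hmap := hIF.map_prod_eq_prod_map_map hUX.aemeasurable hQ.aemeasurable
  rw [hlaw] at hmap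
  have hmeas : Measurable fun z : (ℝ × ℝ) × ℝ => z.1.1 * signAt z.1.2 z.2 :=
    (measurable_fst.comp measurable_fst).mul
      (measurable_signAt.comp ((measurable_snd.comp measurable_fst).prodMk measurable_snd))
  have := Measure.isProbabilityMeasure_map (μ := ν) hUX.aemeasurable
  have hint : Integrable (fun z : (ℝ × ℝ) × ℝ => z.1.1 * signAt z.1.2 z.2)
      ((ν.map fun ω => (U ω, X ω)).prod ρ) := by
    rw [← hmap, integrable_map_measure hmeas.aestronglyMeasurable (hUX.prodMk hQ).aemeasurable]
    refine hUint.mono (hmeas.comp (hUX.prodMk hQ)).aestronglyMeasurable (ae_of_all _ fun ω => ?_)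
    simp [abs_signAt]
  calc ∫ ω, U ω * signAt (X ω) (Q ω) ∂ν
      = ∫ z, z.1.1 * signAt z.1.2 z.2 ∂(ν.map fun ω => ((U ω, X ω), Q ω)) :=
        (integral_map (hUX.prodMk hQ).aemeasurable hmeas.aestronglyMeasurable).symm
    _ = ∫ w, w.1 * meanSign ρ w.2 ∂(ν.map fun ω => (U ω, X ω)) := by
        rw [hmap, integral_prod _ hint]
        simp only [integral_const_mul, meanSign]
    _ = ∫ ω, U ω * meanSign ρ (X ω) ∂ν :=
        integral_map hUX.aemeasurable
          (measurable_fst.mul ((measurable_meanSign ρ).comp measurable_snd)).aestronglyMeasurable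

section

variable {Ω : Type*} [mΩ : MeasurableSpace Ω] {ν : Measure Ω} {ρ : Measure ℝ} {τ : ℕ → ℝ}
  {p : ℕ → Ω → ℝ} {x₀ : ℝ}

lemma measurable_sample_past (hp : ∀ k, Measurable (p k)) {k n : ℕ} (h : k < n) :
    Measurable[pastFiltration p hp n] (p k) := by
  have hle : MeasurableSpace.comap (p k) inferInstance ≤ pastFiltration p hp n :=
    le_biSup (fun k => MeasurableSpace.comap (p k) inferInstance) (Set.mem_Iio.2 h)
  exact (comap_measurable (p k)).mono hle le_rfl

lemma indep_past_sample (hp : ∀ k, Measurable (p k)) (hind : iIndepFun p ν) (n : ℕ) :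
    Indep (pastFiltration p hp n) (MeasurableSpace.comap (p n) inferInstance) ν := by
  have h := indep_iSup_of_disjoint (fun k => (hp k).comap_le) hind
    (S := Set.Iio n) (T := {n}) (by simp)
  simp only [Set.mem_singleton_iff, iSup_iSup_eq_left] at h
  exact h

lemma measurable_signWalk_past (hp : ∀ k, Measurable (p k)) (n : ℕ) :
    Measurable[pastFiltration p hp n] (signWalk τ p x₀ n) := by
  induction n with
  | zero => exact @measurable_const _ _ _ (pastFiltration p hp 0) x₀
  | succ n ih =>
    have h1 := ih.mono ((pastFiltration p hp).mono n.le_succ) le_rfl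
    have h2 := measurable_sample_past hp n.lt_succ_self
    exact h1.sub ((measurable_signAt.comp (h1.prodMk h2)).const_mul _)

lemma measurable_noiseTerm_past [IsProbabilityMeasure ρ] (hp : ∀ k, Measurable (p k)) {k n : ℕ}
    (h : k < n) :
    Measurable[pastFiltration p hp n] fun ω =>
      τ k * (meanSign ρ (signWalk τ p x₀ k ω) - signAt (signWalk τ p x₀ k ω) (p k ω)) := by
  have h1 : Measurable[pastFiltration p hp n] (signWalk τ p x₀ k) :=
    (measurable_signWalk_past hp k).mono ((pastFiltration p hp).mono h.le) le_rfl
  have h2 := measurable_sample_past hp h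
  exact (((measurable_meanSign ρ).comp h1).sub (measurable_signAt.comp (h1.prodMk h2))).const_mul _

lemma measurable_walkNoise_past [IsProbabilityMeasure ρ] (hp : ∀ k, Measurable (p k)) (n : ℕ) :
    Measurable[pastFiltration p hp n] (walkNoise ρ τ p x₀ n) :=
  Finset.measurable_sum _ fun _ hk => measurable_noiseTerm_past hp (Finset.mem_range.1 hk)

/-- Each noise increment is orthogonal to every integrable function of the past. -/
lemma integral_mul_noiseTerm [IsProbabilityMeasure ν] [IsProbabilityMeasure ρ]
    (hp : ∀ k, Measurable (p k)) (hind : iIndepFun p ν) (hlaw : ∀ k, ν.map (p k) = ρ)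
    (n : ℕ) {U : Ω → ℝ} (hU : Measurable[pastFiltration p hp n] U) (hUint : Integrable U ν) :
    ∫ ω, U ω * (τ n * (meanSign ρ (signWalk τ p x₀ n ω) -
      signAt (signWalk τ p x₀ n ω) (p n ω))) ∂ν = 0 := by
  have hX' : Measurable[pastFiltration p hp n] (signWalk τ p x₀ n) := measurable_signWalk_past hp n
  have hX : Measurable (signWalk τ p x₀ n) := hX'.mono ((pastFiltration p hp).le n) le_rfl
  have h := integral_mul_signAt_of_indep ((pastFiltration p hp).le n) hU hX' (hp n)
    (indep_past_sample hp hind n) (hlaw n) hUint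
  have hi1 : Integrable (fun ω => U ω * signAt (signWalk τ p x₀ n ω) (p n ω)) ν :=
    hUint.mul_bdd (c := 1) (measurable_signAt.comp (hX.prodMk (hp n))).aestronglyMeasurable
      (ae_of_all _ fun ω => (abs_signAt _ _).le)
  have hi2 : Integrable (fun ω => U ω * meanSign ρ (signWalk τ p x₀ n ω)) ν :=
    hUint.mul_bdd (c := 1) ((measurable_meanSign ρ).comp hX).aestronglyMeasurable
      (ae_of_all _ fun ω => abs_meanSign_le ρ _)
  have heq : ∀ ω, U ω * (τ n * (meanSign ρ (signWalk τ p x₀ n ω) -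
      signAt (signWalk τ p x₀ n ω) (p n ω))) = τ n * (U ω * meanSign ρ (signWalk τ p x₀ n ω) -
      U ω * signAt (signWalk τ p x₀ n ω) (p n ω)) := fun ω => by ring
  simp only [heq]
  rw [integral_const_mul, integral_sub hi2 hi1, h, sub_self, mul_zero]

lemma measurable_walkNoise [IsProbabilityMeasure ρ] (hp : ∀ k, Measurable (p k)) (n : ℕ) :
    Measurable (walkNoise ρ τ p x₀ n) :=
  (measurable_walkNoise_past hp n).mono ((pastFiltration p hp).le n) le_rfl

lemma integrable_walkNoise [IsProbabilityMeasure ν] [IsProbabilityMeasure ρ]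
    (hp : ∀ k, Measurable (p k)) (hτ : ∀ k, 0 < τ k) (n : ℕ) :
    Integrable (walkNoise ρ τ p x₀ n) ν :=
  .of_bound (measurable_walkNoise hp n).aestronglyMeasurable _
    (ae_of_all _ fun ω => abs_walkNoise_le hτ n ω)

lemma integrable_noiseTerm [IsProbabilityMeasure ν] [IsProbabilityMeasure ρ]
    (hp : ∀ k, Measurable (p k)) (hτ : ∀ k, 0 < τ k) (n : ℕ) :
    Integrable (fun ω => τ n * (meanSign ρ (signWalk τ p x₀ n ω) -
      signAt (signWalk τ p x₀ n ω) (p n ω))) ν :=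
  .of_bound ((measurable_noiseTerm_past hp n.lt_succ_self).mono
      ((pastFiltration p hp).le (n + 1)) le_rfl).aestronglyMeasurable _
    (ae_of_all _ fun ω => abs_noiseTerm_le hτ n ω)

lemma martingale_walkNoise [IsProbabilityMeasure ν] [IsProbabilityMeasure ρ]
    (hp : ∀ k, Measurable (p k)) (hind : iIndepFun p ν) (hlaw : ∀ k, ν.map (p k) = ρ)
    (hτ : ∀ k, 0 < τ k) :
    Martingale (walkNoise ρ τ p x₀) (pastFiltration p hp) ν := by
  have hint := fun n => integrable_walkNoise (ν := ν) (ρ := ρ) (x₀ := x₀) hp hτ n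
  refine martingale_of_setIntegral_eq_succ
    (fun n => (measurable_walkNoise_past hp n).stronglyMeasurable) hint fun n s hs => ?_
  have hs' := (pastFiltration p hp).le n s hs
  have h := integral_mul_noiseTerm (τ := τ) (x₀ := x₀) hp hind hlaw n
    (U := s.indicator fun _ => 1) ((@measurable_const ℝ Ω _ (pastFiltration p hp n) 1).indicator hs)
    ((integrable_const (1 : ℝ)).indicator hs')
  have h2 : ∫ ω in s, τ n * (meanSign ρ (signWalk τ p x₀ n ω) -
      signAt (signWalk τ p x₀ n ω) (p n ω)) ∂ν = 0 := by
    rw [← integral_indicator hs', ← h]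
    congr 1
    funext ω
    by_cases hω : ω ∈ s <;> simp [hω]
  simp only [walkNoise_succ]
  rw [integral_add (hint n).integrableOn (integrable_noiseTerm hp hτ n).integrableOn, h2, add_zero]

/-- By orthogonality of the increments, the second moment of the noise is the sum of those of its
increments, each of which is at most `4 * τ k ^ 2`. -/
lemma integral_sq_walkNoise_le [IsProbabilityMeasure ν] [IsProbabilityMeasure ρ]
    (hp : ∀ k, Measurable (p k)) (hind : iIndepFun p ν) (hlaw : ∀ k, ν.map (p k) = ρ)
    (hτ : ∀ k, 0 < τ k) (n : ℕ) :
    ∫ ω, walkNoise ρ τ p x₀ n ω ^ 2 ∂ν ≤ ∑ k ∈ Finset.range n, 4 * τ k ^ 2 := by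
  induction n with
  | zero => simp [walkNoise]
  | succ n ih =>
    set D : Ω → ℝ := fun ω => τ n * (meanSign ρ (signWalk τ p x₀ n ω) -
      signAt (signWalk τ p x₀ n ω) (p n ω))
    have horth : ∫ ω, walkNoise ρ τ p x₀ n ω * D ω ∂ν = 0 :=
      integral_mul_noiseTerm hp hind hlaw n (measurable_walkNoise_past hp n)
        (integrable_walkNoise hp hτ n)
    have hM := integrable_walkNoise (ν := ν) (ρ := ρ) (x₀ := x₀) hp hτ n
    have hDint : Integrable D ν := integrable_noiseTerm hp hτ n
    have hDb : ∀ ω, |D ω| ≤ 2 * τ n := fun ω => abs_noiseTerm_le hτ n ω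
    have hMM : Integrable (fun ω => walkNoise ρ τ p x₀ n ω ^ 2) ν := by
      simp only [sq]
      exact hM.mul_bdd hM.aestronglyMeasurable (ae_of_all _ fun ω => abs_walkNoise_le hτ n ω)
    have hMD : Integrable (fun ω => walkNoise ρ τ p x₀ n ω * D ω) ν :=
      hM.mul_bdd hDint.aestronglyMeasurable (ae_of_all _ hDb)
    have hDD : Integrable (fun ω => D ω ^ 2) ν := by
      simp only [sq]
      exact hDint.mul_bdd hDint.aestronglyMeasurable (ae_of_all _ hDb)
    have hexp : ∀ ω, walkNoise ρ τ p x₀ (n + 1) ω ^ 2 = walkNoise ρ τ p x₀ n ω ^ 2 +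
        2 * (walkNoise ρ τ p x₀ n ω * D ω) + D ω ^ 2 := fun ω => by
      rw [walkNoise_succ]; ring
    have hD2 : ∫ ω, D ω ^ 2 ∂ν ≤ 4 * τ n ^ 2 := by
      calc ∫ ω, D ω ^ 2 ∂ν ≤ ∫ _, 4 * τ n ^ 2 ∂ν := by
            refine integral_mono hDD (integrable_const _) fun ω => ?_
            have := sq_le_sq' (abs_le.1 (hDb ω)).1 (abs_le.1 (hDb ω)).2
            simp only
            linarith
        _ = 4 * τ n ^ 2 := by simp
    simp only [hexp]
    rw [integral_add (f := fun ω => walkNoise ρ τ p x₀ n ω ^ 2 + 2 * (walkNoise ρ τ p x₀ n ω * D ω))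
      (hMM.add (hMD.const_mul 2)) hDD, integral_add hMM (hMD.const_mul 2),
      integral_const_mul, horth, Finset.sum_range_succ]
    linarith

/-- The noise is an `L²`-bounded martingale since `∑ τ k ^ 2` converges, so it converges almost
surely. -/
lemma ae_exists_tendsto_walkNoise [IsProbabilityMeasure ν] [IsProbabilityMeasure ρ]
    (hp : ∀ k, Measurable (p k)) (hind : iIndepFun p ν) (hlaw : ∀ k, ν.map (p k) = ρ)
    (hτ : ∀ k, 0 < τ k) (hsq : Summable fun k => τ k ^ 2) :
    ∀ᵐ ω ∂ν, ∃ L, Tendsto (fun n => walkNoise ρ τ p x₀ n ω) atTop (𝓝 L) := by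
  have hmart := martingale_walkNoise (x₀ := x₀) hp hind hlaw hτ
  refine hmart.submartingale.exists_ae_tendsto_of_bdd
    (R := (1 + ∑' k, 4 * τ k ^ 2).toNNReal) fun n => ?_
  have hM := integrable_walkNoise (ν := ν) (ρ := ρ) (x₀ := x₀) hp hτ n
  have hMM : Integrable (fun ω => walkNoise ρ τ p x₀ n ω ^ 2) ν := by
    simp only [sq]
    exact hM.mul_bdd hM.aestronglyMeasurable (ae_of_all _ fun ω => abs_walkNoise_le hτ n ω)
  rw [eLpNorm_one_eq_lintegral_enorm, ← ofReal_integral_norm_eq_lintegral_enorm hM]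
  refine ENNReal.ofReal_le_ofReal ?_
  calc ∫ ω, ‖walkNoise ρ τ p x₀ n ω‖ ∂ν ≤ ∫ ω, 1 + walkNoise ρ τ p x₀ n ω ^ 2 ∂ν := by
        refine integral_mono hM.norm ((integrable_const 1).add hMM) fun ω => ?_
        simp only [Real.norm_eq_abs]
        rw [← sq_abs]
        nlinarith [sq_nonneg (|walkNoise ρ τ p x₀ n ω| - 1), abs_nonneg (walkNoise ρ τ p x₀ n ω)]
    _ = 1 + ∫ ω, walkNoise ρ τ p x₀ n ω ^ 2 ∂ν := by
        rw [integral_add (integrable_const 1) hMM]; simp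
    _ ≤ 1 + ∑' k, 4 * τ k ^ 2 := by
        have := integral_sq_walkNoise_le (x₀ := x₀) hp hind hlaw hτ n
        have := (hsq.mul_left 4).sum_le_tsum (Finset.range n) fun k _ => by positivity
        linarith

/-- Almost sure convergence of the walk to a point where the mean sign changes sign strictly. -/
lemma ae_tendsto_signWalk [IsProbabilityMeasure ν] [IsProbabilityMeasure ρ]
    (hp : ∀ k, Measurable (p k)) (hind : iIndepFun p ν) (hlaw : ∀ k, ν.map (p k) = ρ)
    (hτ : ∀ k, 0 < τ k) (hsq : Summable fun k => τ k ^ 2)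
    (hsum : Tendsto (fun n => ∑ k ∈ Finset.range n, τ k) atTop atTop) {m : ℝ}
    (hpos : ∀ u, m < u → 0 < meanSign ρ u) (hneg : ∀ u, u < m → meanSign ρ u < 0) :
    ∀ᵐ ω ∂ν, Tendsto (fun n => signWalk τ p x₀ n ω) atTop (𝓝 m) := by
  have hτ0 : Tendsto τ atTop (𝓝 0) := by
    have h := hsq.tendsto_atTop_zero.sqrt
    simpa [Real.sqrt_sq (hτ _).le] using h
  filter_upwards [ae_exists_tendsto_walkNoise (x₀ := x₀) hp hind hlaw hτ hsq] with ω ⟨L, hL⟩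
  refine tendsto_of_perturbed_drift (fun n => ?_) hτ hτ0 hsum (abs_meanSign_le ρ)
    (monotone_meanSign ρ) hpos hneg hL
  rw [signWalk_succ, walkNoise_succ]
  ring

end

/-! ### Coordinate laws of a measure on a planar set -/

/-- The law of the `i`-th coordinate under a measure on a subset of the plane. -/
noncomputable def coordLaw {K : Set Plane} (μ : Measure K) (i : Fin 2) : Measure ℝ :=
  μ.map fun z : K => (z : Plane) i

section

variable {K : Set Plane} {μ : Measure K} {i : Fin 2}

lemma measurable_coord (i : Fin 2) : Measurable fun z : Plane => z i :=
  (PiLp.continuous_apply 2 _ i).measurable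

lemma measurable_coord_val (i : Fin 2) : Measurable fun z : K => (z : Plane) i :=
  (measurable_coord i).comp measurable_subtype_coe

instance [IsProbabilityMeasure μ] : IsProbabilityMeasure (coordLaw μ i) :=
  Measure.isProbabilityMeasure_map (measurable_coord_val i).aemeasurable

lemma coordLaw_apply {s : Set ℝ} (hs : MeasurableSet s) :
    coordLaw μ i s = μ {z : K | (z : Plane) i ∈ s} :=
  Measure.map_apply (measurable_coord_val i) hs

lemma map_coord_map_val (i : Fin 2) :
    (μ.map (Subtype.val : K → Plane)).map (fun z => z i) = coordLaw μ i :=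
  Measure.map_map (measurable_coord i) measurable_subtype_coe

lemma nullSingletonClass_coordLaw (h : ∀ x : ℝ, μ {z : K | (z : Plane) i = x} = 0) :
    NullSingletonClass (coordLaw μ i) :=
  ⟨fun x => by rw [coordLaw_apply (measurableSet_singleton x)]; exact h x⟩

/-- Connectedness of `K` enters here: the projection of `K` is an interval, and over each of its
points there is a point of `K`, around which `μ` has mass. -/
lemma coordLaw_Ioo_pos (hK : IsPreconnected K)
    (hball : ∀ p ∈ K, ∀ ε : ℝ, 0 < ε → 0 < μ {z : K | (z : Plane) ∈ Metric.ball p ε})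
    {c d : ℝ} (hcd : c < d) (hc : 0 < coordLaw μ i (Set.Iic c))
    (hd : 0 < coordLaw μ i (Set.Ici d)) : 0 < coordLaw μ i (Set.Ioo c d) := by
  rw [coordLaw_apply measurableSet_Iic] at hc
  rw [coordLaw_apply measurableSet_Ici] at hd
  rw [coordLaw_apply measurableSet_Ioo]
  obtain ⟨u, hu⟩ := nonempty_of_measure_ne_zero hc.ne'
  obtain ⟨w, hw⟩ := nonempty_of_measure_ne_zero hd.ne'
  simp only [Set.mem_ofPred_eq, Set.mem_Iic, Set.mem_Ici] at hu hw
  have hproj : IsPreconnected ((fun z : Plane => z i) '' K) :=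
    hK.image _ (PiLp.continuous_apply 2 _ i).continuousOn
  obtain ⟨r, hrK, hr⟩ := hproj.Icc_subset ⟨u, u.2, rfl⟩ ⟨w, w.2, rfl⟩
    (show (c + d) / 2 ∈ Set.Icc ((u : Plane) i) ((w : Plane) i) from
      ⟨by linarith, by linarith⟩)
  refine (hball r hrK ((d - c) / 2) (by linarith)).trans_le (measure_mono fun z hz => ?_)
  simp only [Set.mem_ofPred_eq, Metric.mem_ball, dist_eq_norm] at hz
  have h1 := (PiLp.norm_apply_le ((z : Plane) - r) i).trans_lt hz
  simp only [PiLp.sub_apply, Real.norm_eq_abs, abs_lt] at h1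
  simp only at hr
  exact ⟨by linarith, by linarith⟩

lemma IsCompact.exists_coord_mem_Icc (hK : IsCompact K) (i : Fin 2) :
    ∃ a b, ∀ z ∈ K, z i ∈ Set.Icc a b := by
  have h := (hK.image (PiLp.continuous_apply 2 (fun _ : Fin 2 => ℝ) i)).isBounded
  obtain ⟨a, ha⟩ := h.bddBelow
  obtain ⟨b, hb⟩ := h.bddAbove
  exact ⟨a, b, fun z hz => ⟨ha ⟨z, hz, rfl⟩, hb ⟨z, hz, rfl⟩⟩⟩

lemma ae_coordLaw_mem {s : Set ℝ} (hs : MeasurableSet s) (h : ∀ z ∈ K, z i ∈ s) :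
    ∀ᵐ a ∂coordLaw μ i, a ∈ s :=
  (ae_map_iff (measurable_coord_val i).aemeasurable hs).2 (ae_of_all _ fun z => h z z.2)

lemma integrable_abs_sub_coordLaw [IsProbabilityMeasure μ] (hK : IsCompact K) (x : ℝ) :
    Integrable (fun a => |x - a|) (coordLaw μ i) := by
  obtain ⟨a, b, hab⟩ := hK.exists_coord_mem_Icc i
  refine .of_bound (by fun_prop) (|x| + (|a| + |b|)) ?_
  filter_upwards [ae_coordLaw_mem measurableSet_Icc hab] with y hy
  rw [Real.norm_eq_abs, abs_abs]
  refine (abs_sub x y).trans (add_le_add le_rfl (abs_le.2 ⟨?_, ?_⟩))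
  · linarith [hy.1, neg_abs_le a, abs_nonneg b]
  · linarith [hy.2, le_abs_self b, abs_nonneg a]

lemma conicFunction_eq [IsProbabilityMeasure μ] (hK : IsCompact K) (x : Plane) :
    conicFunction K μ x =
      ∫ a, |x 0 - a| ∂coordLaw μ 0 + ∫ a, |x 1 - a| ∂coordLaw μ 1 := by
  have hm : ∀ j : Fin 2, AEStronglyMeasurable (fun a : ℝ => |x j - a|) (coordLaw μ j) :=
    fun j => by fun_prop
  have hi : ∀ j : Fin 2, Integrable (fun z : K => |x j - (z : Plane) j|) μ := fun j =>
    (integrable_map_measure (hm j) (measurable_coord_val j).aemeasurable).1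
      (integrable_abs_sub_coordLaw hK (x j))
  have he : ∀ j : Fin 2, ∫ a, |x j - a| ∂coordLaw μ j = ∫ z : K, |x j - (z : Plane) j| ∂μ :=
    fun j => integral_map (measurable_coord_val j).aemeasurable (hm j)
  rw [he, he, ← integral_add (hi 0) (hi 1)]
  rfl

lemma isUniqueGlobalMinimizer_conicFunction [IsProbabilityMeasure μ] (hK : IsCompact K)
    {m : Plane} (hm : ∀ j, meanSign (coordLaw μ j) (m j) = 0)
    (hpos : ∀ j u, m j < u → 0 < meanSign (coordLaw μ j) u)
    (hneg : ∀ j u, u < m j → meanSign (coordLaw μ j) u < 0) :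
    IsUniqueGlobalMinimizer (conicFunction K μ) m := by
  have hlt : ∀ j x, x ≠ m j →
      ∫ a, |m j - a| ∂coordLaw μ j < ∫ a, |x - a| ∂coordLaw μ j := fun j x hx =>
    integral_abs_sub_lt_of_ne _ (integrable_abs_sub_coordLaw hK) (hm j) (hpos j) (hneg j) hx
  have hle : ∀ j x, ∫ a, |m j - a| ∂coordLaw μ j ≤ ∫ a, |x - a| ∂coordLaw μ j := fun j x => by
    by_cases h : x = m j
    · rw [h]
    · exact (hlt j x h).le
  refine ⟨fun x => ?_, fun b hb => ?_⟩
  · rw [conicFunction_eq hK, conicFunction_eq hK]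
    exact add_le_add (hle 0 _) (hle 1 _)
  · by_contra hne
    have h := hb m
    rw [conicFunction_eq hK, conicFunction_eq hK] at h
    by_cases h0 : b 0 = m 0
    · have h1 : b 1 ≠ m 1 := fun h1 => hne (by ext j; fin_cases j <;> assumption)
      linarith [hle 0 (b 0), hlt 1 (b 1) h1]
    · linarith [hle 1 (b 1), hlt 0 (b 0) h0]

end

/-! ### The planar recursion -/

lemma signStep_apply (x p : Plane) (i : Fin 2) : signStep x p i = signAt (x i) (p i) := by
  by_cases h0 : p 0 ≤ x 0 <;> by_cases h1 : p 1 ≤ x 1 <;> fin_cases i <;>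
    simp [signStep, signAt, h0, h1]

lemma stochasticRecursion_apply {Ω : Type*} (t : ℕ → ℝ) (P : ℕ → Ω → Plane) (x₀ : Plane)
    (n : ℕ) (ω : Ω) (i : Fin 2) : stochasticRecursion t P x₀ n ω i =
      signWalk (fun k => t (k + 1)) (fun k ω => P (k + 1) ω i) (x₀ i) n ω := by
  induction n with
  | zero => rfl
  | succ n ih => simp [stochasticRecursion, signWalk_succ, ih, signStep_apply]

lemma stochasticRecursion_eq {Ω : Type*} (t : ℕ → ℝ) (P : ℕ → Ω → Plane) (x₀ : Plane)
    (n : ℕ) (ω : Ω) : stochasticRecursion t P x₀ n ω = WithLp.toLp 2 fun i =>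
      signWalk (fun k => t (k + 1)) (fun k ω => P (k + 1) ω i) (x₀ i) n ω := by
  ext i
  exact stochasticRecursion_apply t P x₀ n ω i

lemma norm_le_abs_add_abs (x : Plane) : ‖x‖ ≤ |x 0| + |x 1| := by
  rw [EuclideanSpace.norm_eq, Fin.sum_univ_two]
  refine Real.sqrt_le_iff.2 ⟨by positivity, ?_⟩
  simp only [Real.norm_eq_abs]
  nlinarith [abs_nonneg (x 0), abs_nonneg (x 1)]

/-- Almost sure convergence of a uniformly bounded sequence of measurable maps gives convergence of
all moments of the distance to the limit. -/
lemma memLp_and_tendsto_integral_norm_pow {Ω E : Type*} [MeasurableSpace Ω] {ν : Measure Ω}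
    [IsProbabilityMeasure ν] [NormedAddCommGroup E] {X : ℕ → Ω → E} {x : E} {C : ℝ}
    (hX : ∀ n, AEStronglyMeasurable (X n) ν) (hC : ∀ᵐ ω ∂ν, ∀ n, ‖X n ω‖ ≤ C)
    (hlim : ∀ᵐ ω ∂ν, Tendsto (fun n => X n ω) atTop (𝓝 x)) {q : ℕ} (hq : q ≠ 0) :
    (∀ n, MemLp (X n) (q : ENNReal) ν) ∧
      Tendsto (fun n => ∫ ω, ‖X n ω - x‖ ^ q ∂ν) atTop (𝓝 0) := by
  refine ⟨fun n => .of_bound (hX n) C (hC.mono fun ω h => h n), ?_⟩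
  have h := tendsto_integral_of_dominated_convergence (μ := ν) (f := fun _ => (0 : ℝ))
    (F := fun n ω => ‖X n ω - x‖ ^ q) (fun _ => (C + ‖x‖) ^ q)
    (fun n => ((hX n).sub aestronglyMeasurable_const).norm.pow q) (integrable_const _)
    (fun n => hC.mono fun ω h => by
      rw [norm_pow, norm_norm]
      exact pow_le_pow_left₀ (norm_nonneg _) ((norm_sub_le _ _).trans (by linarith [h n])) q)
    (hlim.mono fun ω h => by
      have h1 := ((h.sub_const x).norm).pow q
      rwa [sub_self, norm_zero, zero_pow hq] at h1)
  simpa using h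

theorem mainTheorem1
    (K : Set Plane) (hK : IsCompactBody K) (hK_conn : IsConnected K)
    (μ : Measure K) [IsProbabilityMeasure μ]
    (hμ_ball : ∀ p ∈ K, ∀ ε : ℝ, 0 < ε → 0 < μ {z : K | (z : Plane) ∈ Metric.ball p ε})
    (hμ_vert : ∀ x : ℝ, μ {z : K | (z : Plane) 0 = x} = 0)
    (hμ_horiz : ∀ y : ℝ, μ {z : K | (z : Plane) 1 = y} = 0)
    (t : ℕ → ℝ) (ht_pos : ∀ k, 1 ≤ k → 0 < t k) (ht_decr : ∀ k, 1 ≤ k → t (k + 1) ≤ t k)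
    (ht_sum : Tendsto (fun n : ℕ => ∑ k ∈ Finset.Icc 1 n, t k) atTop atTop)
    (ht_sq : Summable (fun k : ℕ => t (k + 1) ^ 2))
    {Ω : Type*} [MeasurableSpace Ω] (ν : Measure Ω) [IsProbabilityMeasure ν]
    (P : ℕ → Ω → Plane) (hP_meas : ∀ k, 1 ≤ k → Measurable (P k))
    (hP_indep : iIndepFun (fun k : ℕ => P (k + 1)) ν)
    (hP_law : ∀ k, 1 ≤ k → Measure.map (P k) ν = Measure.map (Subtype.val : K → Plane) μ)
    (x₀ : Plane) (hx₀ : x₀ ∈ K) :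
    ∃ Xstar : Plane,
      IsUniqueGlobalMinimizer (conicFunction K μ) Xstar ∧
      (∀ᵐ ω ∂ν, Tendsto (fun n : ℕ => stochasticRecursion t P x₀ n ω) atTop (𝓝 Xstar)) ∧
      ∀ q : ℕ, 1 ≤ q →
        (∀ n : ℕ, MemLp (stochasticRecursion t P x₀ n) (q : ENNReal) ν) ∧
        Tendsto (fun n : ℕ => ∫ ω, ‖stochasticRecursion t P x₀ n ω - Xstar‖ ^ q ∂ν)
          atTop (𝓝 0) := by
  have hKc : IsCompact K := hK.2.1
  have hnull : ∀ i : Fin 2, NullSingletonClass (coordLaw μ i) := fun i =>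
    nullSingletonClass_coordLaw (by fin_cases i; exacts [hμ_vert, hμ_horiz])
  have hmed := fun i : Fin 2 => exists_strict_median (coordLaw μ i) fun c d hcd hc hd =>
    coordLaw_Ioo_pos hK_conn.isPreconnected hμ_ball hcd hc hd
  choose m hm hpos hneg using hmed
  set τ : ℕ → ℝ := fun k => t (k + 1)
  set p : Fin 2 → ℕ → Ω → ℝ := fun i k ω => P (k + 1) ω i
  have hτ : ∀ k, 0 < τ k := fun k => ht_pos _ (by omega)
  have hanti : Antitone τ := antitone_nat_of_succ_le fun k => ht_decr _ (by omega)
  have hsum : Tendsto (fun n => ∑ k ∈ Finset.range n, τ k) atTop atTop := by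
    convert! ht_sum using 2 with n
    rw [Finset.range_eq_Ico, Finset.sum_Ico_add' t 0 n 1]
    rfl
  have hp : ∀ i k, Measurable (p i k) := fun i k =>
    (measurable_coord i).comp (hP_meas _ (by omega))
  have hind : ∀ i, iIndepFun (p i) ν := fun i =>
    hP_indep.comp (fun _ z => z i) fun _ => measurable_coord i
  have hlaw : ∀ i k, ν.map (p i k) = coordLaw μ i := fun i k => by
    rw [← map_coord_map_val, ← hP_law (k + 1) (by omega),
      Measure.map_map (measurable_coord i) (hP_meas _ (by omega))]
    rfl
  have hconv : ∀ᵐ ω ∂ν,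
      Tendsto (fun n : ℕ => stochasticRecursion t P x₀ n ω) atTop (𝓝 (WithLp.toLp 2 m)) := by
    have h := ae_all_iff.2 fun i => ae_tendsto_signWalk (x₀ := x₀ i) (hp i) (hind i) (hlaw i) hτ
      ht_sq hsum (hpos i) (hneg i)
    filter_upwards [h] with ω hω
    simp only [stochasticRecursion_eq]
    exact ((PiLp.continuous_toLp 2 _).tendsto m).comp (tendsto_pi_nhds.2 hω)
  choose a b hab using fun i => hKc.exists_coord_mem_Icc i
  have hbdd : ∀ᵐ ω ∂ν, ∀ n, ‖stochasticRecursion t P x₀ n ω‖ ≤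
      (max |a 0 - τ 0| |b 0 + τ 0|) + (max |a 1 - τ 0| |b 1 + τ 0|) := by
    have h : ∀ᵐ ω ∂ν, ∀ i k, p i k ω ∈ Set.Icc (a i) (b i) := by
      refine ae_all_iff.2 fun i => ae_all_iff.2 fun k => ?_
      have h := ae_coordLaw_mem (μ := μ) measurableSet_Icc (hab i)
      rw [← hlaw i k] at h
      exact ae_of_ae_map (hp i k).aemeasurable h
    filter_upwards [h] with ω hω n
    have hi : ∀ i, |stochasticRecursion t P x₀ n ω i| ≤ max |a i - τ 0| |b i + τ 0| := fun i => by
      rw [stochasticRecursion_apply]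
      have h := signWalk_mem_Icc (hab i x₀ hx₀) hτ hanti (hω i) n
      exact abs_le_max_abs_abs h.1 h.2
    exact (norm_le_abs_add_abs _).trans (add_le_add (hi 0) (hi 1))
  have hmeas : ∀ n, AEStronglyMeasurable (stochasticRecursion t P x₀ n) ν := fun n => by
    have h : Measurable fun ω => (WithLp.toLp 2 fun i => signWalk τ (p i) (x₀ i) n ω : Plane) :=
      (PiLp.continuous_toLp 2 _).measurable.comp (measurable_pi_lambda _ fun i =>
        (measurable_signWalk_past (hp i) n).mono ((pastFiltration (p i) (hp i)).le n) le_rfl)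
    rw [show stochasticRecursion t P x₀ n = _ from funext (stochasticRecursion_eq t P x₀ n)]
    exact h.aestronglyMeasurable
  exact ⟨WithLp.toLp 2 m, isUniqueGlobalMinimizer_conicFunction hKc hm hpos hneg, hconv,
    fun q hq => memLp_and_tendsto_integral_norm_pow hmeas hbdd hconv (by omega)⟩
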